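/- For integers $m,n\ge 3$, let $\vec C_m$ and $\vec C_n$ be the directed cycles with vertex sets $\mathbb{Z}_m$ and $\mathbb{Z}_n$ and directed edges $x\to x+1$. Let $\vec C_m\mathbin{\Box}\vec C_n$ be their Cartesian product: its vertex set is $\mathbb{Z}_m\times\mathbb{Z}_n$, and its directed edges are $(x,y)\to(x+1,y)$ and $(x,y)\to(x,y+1)$. Let $R_{2,2}=\{0,1\}\times\{0,1\}\subset\mathbb{Z}_m\times\mathbb{Z}_n$, and let $(\vec C_m\mathbin{\Box}\vec C_n)\smallsetminus R_{2,2}$ be the digraph obtained by deleting the vertices in $R_{2,2}$ and all directed edges incident with them. For integers $i,j$, let $[i,j]$ denote the integer (unique if it exists, and existing whenever $\gcd(m,n)=1$) such that $$[i,j]\equiv i \pmod m,\qquad [i,j]\equiv j \pmod n,\qquad 1\le [i,j]\le \operatorname{lcm}(m,n).$$ Then $(\vec C_m\mathbin{\Box}\vec C_n)\smallsetminus R_{2,2}$ has a (directed) hamiltonian cycle if and only if all three of the following conditions hold: 1. $\gcd(m,n)=1$; 2. $\min\{[0,-2],\,[-2,0]\}<\min\{[0,-1],\,[-1,0]\}$;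 3. $\displaystyle\gcd\left(\frac{[0,-4]}{m},\ \frac{[-4,0]}{n}\right)=1$. -/

import Mathlib

namespace DirectedTorus

/-- The directed cycle of length `n`: its vertices are the elements of `ZMod n`, and there is a
directed edge from `x` to `y` if and only if `y = x + 1`. -/
def directedCycle (n : ℕ) : Digraph (ZMod n) where
  Adj x y := y = x + 1

/-- The Cartesian product of two digraphs. -/
def boxProd {V W : Type*} (X : Digraph V) (Y : Digraph W) : Digraph (V × W) where
  Adj p q := (p.1 = q.1 ∧ Y.Adj p.2 q.2) ∨ (p.2 = q.2 ∧ X.Adj p.1 q.1)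

/-- The digraph obtained by deleting all the vertices in `S`, together with all the directed edges
that are incident with `S`. -/
def deleteVerts {V : Type*} (X : Digraph V) (S : Set V) : Digraph {v : V // v ∉ S} where
  Adj v w := X.Adj v.1 w.1

/-- A digraph is hamiltonian if it has a directed cycle `c 0, c 1, …, c (k - 1), c 0`
that visits every vertex exactly once. -/
def IsHamiltonian {V : Type*} (X : Digraph V) : Prop :=
  ∃ k : ℕ, 0 < k ∧ ∃ c : ZMod k → V, Function.Bijective c ∧ ∀ i : ZMod k, X.Adj (c i) (c (i + 1))

/-- The rectangle `{0, 1, …, a - 1} × {0, 1, …, b - 1}` in `ZMod m × ZMod n`. -/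
def rectangle (m n a b : ℕ) : Set (ZMod m × ZMod n) :=
  {v | ∃ i j : ℕ, i < a ∧ j < b ∧ v = ((i : ZMod m), (j : ZMod n))}

/-- `x` is congruent to `i` modulo `m` and to `j` modulo `n`, and lies between `1` and
`lcm(m, n)`. -/
def IsCrt (m n : ℕ) (i j x : ℤ) : Prop :=
  x ≡ i [ZMOD m] ∧ x ≡ j [ZMOD n] ∧ 1 ≤ x ∧ x ≤ (Nat.lcm m n : ℤ)

open Classical in
/-- The integer `[i, j]` with `[i, j] ≡ i (mod m)`, `[i, j] ≡ j (mod n)` and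
`1 ≤ [i, j] ≤ lcm(m, n)`. It is unique if it exists; the value is `0` if there is no such
integer. -/
noncomputable def crt (m n : ℕ) (i j : ℤ) : ℤ :=
  if h : ∃ x : ℤ, IsCrt m n i j x then h.choose else 0

theorem IsCrt.unique {m n : ℕ} {i j x y : ℤ} (hx : IsCrt m n i j x) (hy : IsCrt m n i j y) :
    x = y := by
  obtain ⟨hx1, hx2, hx3, hx4⟩ := hx
  obtain ⟨hy1, hy2, hy3, hy4⟩ := hy
  have h1 : (m : ℤ) ∣ y - x := (hx1.trans hy1.symm).dvd
  have h2 : (n : ℤ) ∣ y - x := (hx2.trans hy2.symm).dvd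
  have h3 : ((Nat.lcm m n : ℕ) : ℤ) ∣ y - x := by
    have := lcm_dvd h1 h2
    rwa [← Int.coe_lcm, Int.lcm_natCast_natCast] at this
  have h4 : y - x = 0 := by
    apply Int.eq_zero_of_abs_lt_dvd h3
    rw [abs_lt]
    constructor <;> linarith
  linarith

/-- `[i, j]` exists when `m` and `n` are coprime. -/
theorem crt_spec {m n : ℕ} (hm : 0 < m) (hn : 0 < n) (h : Nat.gcd m n = 1) (i j : ℤ) :
    IsCrt m n i j (crt m n i j) := by
  have hex : ∃ x : ℤ, IsCrt m n i j x := by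
    have hL : (0 : ℤ) < (Nat.lcm m n : ℤ) := by exact_mod_cast Nat.lcm_pos hm hn
    have hmL : (m : ℤ) ∣ (Nat.lcm m n : ℤ) := by exact_mod_cast Nat.dvd_lcm_left m n
    have hnL : (n : ℤ) ∣ (Nat.lcm m n : ℤ) := by exact_mod_cast Nat.dvd_lcm_right m n
    have hc : IsCoprime (m : ℤ) (n : ℤ) := Nat.isCoprime_iff_coprime.mpr h
    obtain ⟨u, v, huv⟩ := hc
    set z : ℤ := i * (v * n) + j * (u * m) with hz
    have hz1 : z ≡ i [ZMOD m] := by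
      apply Int.ModEq.symm
      rw [Int.modEq_iff_dvd]
      exact ⟨(j - i) * u, by rw [hz]; linear_combination i * huv⟩
    have hz2 : z ≡ j [ZMOD n] := by
      apply Int.ModEq.symm
      rw [Int.modEq_iff_dvd]
      exact ⟨(i - j) * v, by rw [hz]; linear_combination j * huv⟩
    have hmod : (z - 1) % (Nat.lcm m n : ℤ) + 1 ≡ z [ZMOD (Nat.lcm m n : ℤ)] := by
      have := (Int.mod_modEq (z - 1) (Nat.lcm m n : ℤ)).add_right 1
      simpa using this
    refine ⟨(z - 1) % (Nat.lcm m n : ℤ) + 1, (hmod.of_dvd hmL).trans hz1,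
      (hmod.of_dvd hnL).trans hz2, ?_, ?_⟩
    · linarith [Int.emod_nonneg (z - 1) hL.ne']
    · linarith [Int.emod_lt_of_pos (z - 1) hL]
  unfold crt
  rw [dif_pos hex]
  exact hex.choose_spec

end DirectedTorus

namespace DirectedTorus

/-! A hamiltonian cycle assigns a direction, east or north, to each remaining vertex. The vertices
`v` and `v + (1, -1)` are the two in-neighbours of `v + (1, 0)`, so away from the hole directions
are constant along the antidiagonals, and the hole forces both where they start and where they
switch.

If `gcd m n` does not divide 2, the antidiagonal of `(0, 0)` meets the hole nowhere else, and an
east run on it never stops (`gcd_dvd_two`). If the gcd is 2, each odd vertex is followed by two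
steps in the same direction, so the parity of the first coordinate is invariant on odd vertices,
which is absurd (`gcd_ne_two_of_cycle`).

If the gcd is 1, the antidiagonal `t ↦ (t, -t)` is a single closed walk of length `mn`. With `e ≡
(1, 0)`, east is `t ↦ t + e`, north is `t ↦ t + e - 1`, and the hole is `{0, e - 1, e, 2e - 1}` mod
`mn`. Either the forced directions clash, which is the failure of condition 2, or they determine
every arc (`types_of_lt`, `types_of_gt`). In the latter case, numbering the remaining `mn - 4`
vertices in order turns the successor map into a rotation by a constant `r`, which is a single cycle
exactly when `r` is prime to `mn - 4`. A unimodular change of variables (`coprime_iff`) turns this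
into condition 3. -/

theorem mem_rectangle_two {m n : ℕ} {v : ZMod m × ZMod n} :
    v ∈ rectangle m n 2 2 ↔ v = (0, 0) ∨ v = (1, 0) ∨ v = (0, 1) ∨ v = (1, 1) := by
  constructor
  · rintro ⟨i, j, hi, hj, rfl⟩
    interval_cases i <;> interval_cases j <;> simp
  · rintro (rfl | rfl | rfl | rfl)
    · exact ⟨0, 0, by simp⟩
    · exact ⟨1, 0, by simp⟩
    · exact ⟨0, 1, by simp⟩
    · exact ⟨1, 1, by simp⟩

/-! ### Cycle covers and their local forcing rules -/

/-- A spanning union of disjoint directed cycles in the complement of the `2 × 2` rectangle: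
`E v` (resp. `N v`) means that the arc leaving `v` goes to `v + (1, 0)` (resp. `v + (0, 1)`). -/
structure IsCover (m n : ℕ) (E N : ZMod m × ZMod n → Prop) : Prop where
  east_left {v} : E v → v ∉ rectangle m n 2 2
  north_left {v} : N v → v ∉ rectangle m n 2 2
  east_right {v} : E v → v + (1, 0) ∉ rectangle m n 2 2
  north_right {v} : N v → v + (0, 1) ∉ rectangle m n 2 2
  out {v} : v ∉ rectangle m n 2 2 → E v ∨ N v
  into {v} : v ∉ rectangle m n 2 2 → E (v - (1, 0)) ∨ N (v - (0, 1))
  out_unique {v} : E v → ¬ N v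
  into_unique {v} : E v → ¬ N (v + (1, -1))

/-- The arcs of a hamiltonian cycle form a cover. -/
theorem isCover_of_cycle {m n k : ℕ} (hm : 3 ≤ m)
    {c : ZMod k → {v : ZMod m × ZMod n // v ∉ rectangle m n 2 2}} (hc : Function.Bijective c)
    (hadj : ∀ i, (deleteVerts (boxProd (directedCycle m) (directedCycle n))
      (rectangle m n 2 2)).Adj (c i) (c (i + 1))) :
    IsCover m n (fun v => ∃ i, (c i).1 = v ∧ (c (i + 1)).1 = v + (1, 0))
      (fun v => ∃ i, (c i).1 = v ∧ (c (i + 1)).1 = v + (0, 1)) := by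
  have h1 : (1 : ZMod m) ≠ 0 := by
    have : Fact (1 < m) := ⟨by omega⟩
    exact one_ne_zero
  have hinj : ∀ {i j}, (c i).1 = (c j).1 → i = j := fun h => hc.1 (Subtype.ext h)
  have hstep : ∀ i, (c (i + 1)).1 = (c i).1 + (1, 0) ∨ (c (i + 1)).1 = (c i).1 + (0, 1) := by
    intro i
    rcases hadj i with ⟨h, h'⟩ | ⟨h, h'⟩
    · exact Or.inr (Prod.ext (by simp [h]) h')
    · exact Or.inl (Prod.ext h' (by simp [h]))
  refine ⟨?_, ?_, ?_, ?_, ?_, ?_, ?_, ?_⟩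
  · rintro v ⟨i, rfl, -⟩
    exact (c i).2
  · rintro v ⟨i, rfl, -⟩
    exact (c i).2
  · rintro v ⟨i, -, h⟩
    exact h ▸ (c (i + 1)).2
  · rintro v ⟨i, -, h⟩
    exact h ▸ (c (i + 1)).2
  · intro v hv
    obtain ⟨i, hi⟩ := hc.2 ⟨v, hv⟩
    have hi' : (c i).1 = v := by rw [hi]
    rcases hstep i with h | h
    · exact Or.inl ⟨i, hi', hi' ▸ h⟩
    · exact Or.inr ⟨i, hi', hi' ▸ h⟩
  · intro v hv
    obtain ⟨i, hi⟩ := hc.2 ⟨v, hv⟩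
    have hi' : (c (i - 1 + 1)).1 = v := by rw [sub_add_cancel, hi]
    rcases hstep (i - 1) with h | h
    · exact Or.inl ⟨i - 1, by rw [← hi', h, add_sub_cancel_right], by rw [hi', sub_add_cancel]⟩
    · exact Or.inr ⟨i - 1, by rw [← hi', h, add_sub_cancel_right], by rw [hi', sub_add_cancel]⟩
  · rintro v ⟨i, hi, hi'⟩ ⟨j, hj, hj'⟩
    obtain rfl := hinj (hi.trans hj.symm)
    have := congrArg Prod.fst (hi'.symm.trans hj')
    simp [h1] at this
  · rintro v ⟨i, hi, hi'⟩ ⟨j, hj, hj'⟩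
    have h : (c (i + 1)).1 = (c (j + 1)).1 := by
      rw [hi', hj']; ext <;> simp
    obtain rfl := add_right_cancel (hinj h)
    have := congrArg Prod.fst (hi.symm.trans hj)
    simp [h1] at this

namespace IsCover

variable {m n : ℕ} {E N : ZMod m × ZMod n → Prop}

/-- The only two vertices with an arc to `v + (1, 0)` are consecutive on an antidiagonal; this is
the source of all propagation. -/
theorem into_east (h : IsCover m n E N) {v : ZMod m × ZMod n}
    (hw : v + (1, 0) ∉ rectangle m n 2 2) : E v ∨ N (v + (1, -1)) := by
  have := h.into hw
  rwa [add_sub_cancel_right,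
    show v + (1, 0) - (0, 1) = v + (1, -1) by ext <;> simp [sub_eq_add_neg]] at this

theorem east_succ (h : IsCover m n E N) {v : ZMod m × ZMod n} (hv : E v)
    (hv' : v + (1, -1) ∉ rectangle m n 2 2) : E (v + (1, -1)) :=
  (h.out hv').resolve_right (h.into_unique hv)

theorem north_succ (h : IsCover m n E N) {v : ZMod m × ZMod n} (hv : N v)
    (hw : v + (1, 0) ∉ rectangle m n 2 2) :
    N (v + (1, -1)) := by
  exact (h.into_east hw).resolve_left fun hE => h.out_unique hE hv

theorem east_of_mem (h : IsCover m n E N) {v : ZMod m × ZMod n} (hv : v ∉ rectangle m n 2 2)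
    (hw : v + (0, 1) ∈ rectangle m n 2 2) : E v :=
  (h.out hv).resolve_right fun hN => h.north_right hN hw

theorem east_of_succ_mem (h : IsCover m n E N) {v : ZMod m × ZMod n}
    (hv : v + (1, -1) ∈ rectangle m n 2 2) (hw : v + (1, 0) ∉ rectangle m n 2 2) : E v := by
  exact (h.into_east hw).resolve_right fun hN => h.north_left hN hv

theorem north_of_pred_mem (h : IsCover m n E N) {v : ZMod m × ZMod n}
    (hv : v ∈ rectangle m n 2 2) (hw : v + (1, 0) ∉ rectangle m n 2 2) : N (v + (1, -1)) := by
  exact (h.into_east hw).resolve_left fun hE => h.east_left hE hv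

end IsCover

/-! ### The antidiagonal walk, and the case of a nontrivial gcd -/

/-- The antidiagonal walk in the torus. -/
def antidiag (m n : ℕ) (t : ℤ) : ZMod m × ZMod n := ((t : ZMod m), ((-t : ℤ) : ZMod n))

theorem antidiag_succ (m n : ℕ) (t : ℤ) : antidiag m n (t + 1) = antidiag m n t + (1, -1) := by
  ext <;> simp [antidiag, add_comm]

theorem antidiag_mem_iff {m n : ℕ} {t : ℤ} :
    antidiag m n t ∈ rectangle m n 2 2 ↔
      ((m : ℤ) ∣ t ∨ (m : ℤ) ∣ t - 1) ∧ ((n : ℤ) ∣ t ∨ (n : ℤ) ∣ t + 1) := by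
  have a0 : (t : ZMod m) = 0 ↔ (m : ℤ) ∣ t := ZMod.intCast_zmod_eq_zero_iff_dvd t m
  have a1 : (t : ZMod m) = 1 ↔ (m : ℤ) ∣ t - 1 := by
    rw [← ZMod.intCast_zmod_eq_zero_iff_dvd]; push_cast; rw [sub_eq_zero]
  have b0 : ((-t : ℤ) : ZMod n) = 0 ↔ (n : ℤ) ∣ t := by
    rw [ZMod.intCast_zmod_eq_zero_iff_dvd, dvd_neg]
  have b1 : ((-t : ℤ) : ZMod n) = 1 ↔ (n : ℤ) ∣ t + 1 := by
    rw [← ZMod.intCast_zmod_eq_zero_iff_dvd]; push_cast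
    rw [neg_eq_iff_eq_neg, ← sub_eq_zero, sub_neg_eq_add]
  rw [mem_rectangle_two]
  simp only [antidiag, Prod.mk.injEq, a0, a1, b0, b1]
  tauto

theorem two_ne_zero_one {n : ℕ} (hn : 3 ≤ n) : (2 : ZMod n) ≠ 0 ∧ (2 : ZMod n) ≠ 1 ∧
    (1 : ZMod n) ≠ 0 ∧ (-1 : ZMod n) ≠ 0 ∧ (-1 : ZMod n) ≠ 1 := by
  have : Fact (1 < n) := ⟨by omega⟩
  have h2 : (2 : ZMod n) ≠ 0 := by
    intro h
    have : ((2 : ℕ) : ZMod n) = 0 := by exact_mod_cast h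
    rw [ZMod.natCast_eq_zero_iff] at this
    exact absurd (Nat.le_of_dvd two_pos this) (by omega)
  have h1 : (1 : ZMod n) ≠ 0 := one_ne_zero
  refine ⟨h2, fun h => h1 ?_, h1, neg_ne_zero.mpr h1, fun h => h2 ?_⟩
  · linear_combination h
  · linear_combination -h

namespace IsCover

variable {m n : ℕ} {E N : ZMod m × ZMod n → Prop}

/-- The vertex `(1, -1)` must go east, since `(1, 0)` is deleted. The antidiagonal avoids `(1, 0)`,
`(0, 1)` and `(1, 1)` because the gcd does not divide 2, so east propagates all the way round to the
deleted `(0, 0)`. -/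
theorem gcd_dvd_two (h : IsCover m n E N) (hm : 3 ≤ m) (hn : 3 ≤ n) : Nat.gcd m n ∣ 2 := by
  by_contra hd
  obtain ⟨-, -, m3, m4, m5⟩ := two_ne_zero_one hm
  obtain ⟨-, -, n3, n4, n5⟩ := two_ne_zero_one hn
  have gm : ((Nat.gcd m n : ℕ) : ℤ) ∣ m := Int.natCast_dvd_natCast.mpr (Nat.gcd_dvd_left m n)
  have gn : ((Nat.gcd m n : ℕ) : ℤ) ∣ n := Int.natCast_dvd_natCast.mpr (Nat.gcd_dvd_right m n)
  have g2 : ¬ ((Nat.gcd m n : ℕ) : ℤ) ∣ 2 := by exact_mod_cast hd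
  have g1 : ¬ ((Nat.gcd m n : ℕ) : ℤ) ∣ 1 := fun h => g2 (h.trans (by norm_num))
  have key : ∀ t : ℕ, E (antidiag m n (t + 1)) := by
    intro t
    induction t with
    | zero =>
      apply h.east_of_mem
      · rw [mem_rectangle_two]
        simp [antidiag, m3, n4, n5]
      · rw [mem_rectangle_two]
        simp [antidiag]
    | succ t ih =>
      rw [antidiag_succ]
      push_cast
      apply h.east_succ ih
      intro hmem
      have hE := h.east_right ih
      rw [← antidiag_succ, antidiag_mem_iff] at hmem
      obtain ⟨hx | hx, hy | hy⟩ := hmem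
      -- Just before `(0, 0)` is `(-1, 1)`, whose east arc would enter the deleted `(0, 1)`.
      · apply hE
        have e1 : (((t + 1 : ℤ) + 1 : ℤ) : ZMod m) = 0 :=
          (ZMod.intCast_zmod_eq_zero_iff_dvd _ _).mpr hx
        have e2 : (((t + 1 : ℤ) + 1 : ℤ) : ZMod n) = 0 :=
          (ZMod.intCast_zmod_eq_zero_iff_dvd _ _).mpr hy
        rw [mem_rectangle_two]
        right; right; left
        push_cast at e1 e2
        ext
        · simp [antidiag, e1]
        · simp only [antidiag, Prod.snd_add]; push_cast; linear_combination -e2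
      · apply g1
        have := dvd_sub (gn.trans hy) (gm.trans hx)
        rwa [add_sub_cancel_left] at this
      · apply g1
        have := dvd_sub (gn.trans hy) (gm.trans hx)
        rwa [sub_sub_cancel] at this
      · apply g2
        have := dvd_sub (gn.trans hy) (gm.trans hx)
        ring_nf at this
        exact this
  have hmn : ((m * n - 1 : ℕ) : ℤ) + 1 = m * n := by
    have : 1 ≤ m * n := Nat.mul_pos (by omega) (by omega)
    push_cast [this]; ring
  have := h.east_left (key (m * n - 1))
  rw [hmn, antidiag_mem_iff] at this
  exact this ⟨Or.inl (dvd_mul_right _ _), Or.inl (dvd_mul_left _ _)⟩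

/-- If `x + y` is odd and `v = (x, y)` is followed by `v + (1, 0)`, then `v + (1, 0)` is
followed by `v + (2, 0)`. -/
theorem east_east (h : IsCover m n E N) (hn : 3 ≤ n)
    (χ : ZMod m × ZMod n →+ ZMod 2) (hχ₁ : χ (1, 0) = 1) (hχ₂ : χ (0, 1) = 1)
    {v : ZMod m × ZMod n} (hodd : χ v = 1) (hE : E v)
    (hv : ∃ t : ℕ, v + t • ((1, -1) : ZMod m × ZMod n) = (0, 1)) : E (v + (1, 0)) := by
  obtain ⟨n1, n2, -, -, -⟩ := two_ne_zero_one hn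
  have hχ₃ : χ (1, -1) = 0 := by
    rw [show ((1, -1) : ZMod m × ZMod n) = (1, 0) - (0, 1) by ext <;> simp, map_sub, hχ₁, hχ₂,
      sub_self]
  refine (h.out (h.east_right hE)).resolve_right fun hN => ?_
  obtain ⟨t, ht⟩ := hv
  -- The pattern "`w` east, `w + (1, 0)` north" is carried along the odd antidiagonal until `w` is
  -- the deleted `(0, 1)`. By parity, only `(1, 0)` and `(0, 1)` can obstruct it.
  have key : ∀ s : ℕ, χ (v + s • ((1, -1) : ZMod m × ZMod n)) = 1 ∧
      E (v + s • ((1, -1) : ZMod m × ZMod n)) ∧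
      N (v + s • ((1, -1) : ZMod m × ZMod n) + (1, 0)) := by
    intro s
    induction s with
    | zero => simpa using ⟨hodd, hE, hN⟩
    | succ s ih =>
      rw [succ_nsmul, ← add_assoc]
      obtain ⟨h0, h1, h2⟩ := ih
      generalize v + s • ((1, -1) : ZMod m × ZMod n) = w at h0 h1 h2
      have h0' : χ (w + (1, -1)) = 1 := by rw [map_add, h0, hχ₃, add_zero]
      have h1' : E (w + (1, -1)) := by
        apply h.east_succ h1
        rw [mem_rectangle_two]
        rintro (h3 | h3 | h3 | h3)
        · rw [h3, show ((0, 0) : ZMod m × ZMod n) = 0 from rfl, map_zero] at h0'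
          exact absurd h0' (by decide)
        · apply h.east_left h1
          rw [eq_sub_of_add_eq h3, mem_rectangle_two]
          simp
        -- Here `w + (1, 0) = (0, 2)`, which must go east because `(1, 2)` cannot be entered from
        -- `(1, 1)`.
        · refine h.out_unique (h.east_of_succ_mem (v := w + (1, 0)) ?_ ?_) h2
          · rw [add_right_comm, h3, mem_rectangle_two]
            simp
          · rw [eq_sub_of_add_eq h3, mem_rectangle_two]
            norm_num [n1, n2]
        · rw [h3, show ((1, 1) : ZMod m × ZMod n) = (1, 0) + (0, 1) by simp, map_add, hχ₁, hχ₂]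
            at h0'
          exact absurd h0' (by decide)
      refine ⟨h0', h1', ?_⟩
      rw [add_right_comm]
      apply h.north_succ h2
      have h4 : χ (w + (1, 0) + (1, 0)) = 1 := by
        rw [map_add, map_add, h0, hχ₁]
        decide
      rw [mem_rectangle_two]
      rintro (h3 | h3 | h3 | h3)
      · rw [h3, show ((0, 0) : ZMod m × ZMod n) = 0 from rfl, map_zero] at h4
        exact absurd h4 (by decide)
      · apply h.north_left h2
        rw [eq_sub_of_add_eq h3, mem_rectangle_two]
        exact Or.inl (sub_self _)
      · apply h.east_right h1'
        rw [show w + (1, -1) + (1, 0) = w + (1, 0) + (1, 0) - (0, 1) by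
          ext <;> simp [sub_eq_add_neg], h3, mem_rectangle_two]
        exact Or.inl (sub_self _)
      · rw [h3, show ((1, 1) : ZMod m × ZMod n) = (1, 0) + (0, 1) by simp, map_add, hχ₁, hχ₂] at h4
        exact absurd h4 (by decide)
  apply h.east_left (key t).2.1
  rw [ht, mem_rectangle_two]
  simp

/-- If `x + y` is odd and `v = (x, y)` is followed by `v + (0, 1)`, then `v + (0, 1)` is
followed by `v + (0, 2)`. -/
theorem north_north (h : IsCover m n E N)
    (χ : ZMod m × ZMod n →+ ZMod 2) (hχ₁ : χ (1, 0) = 1) (hχ₂ : χ (0, 1) = 1)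
    {v : ZMod m × ZMod n} (hodd : χ v = 1) (hN : N v)
    (hv : ∃ t : ℕ, v + t • ((1, -1) : ZMod m × ZMod n) = (0, 1)) : N (v + (0, 1)) := by
  have hχ₃ : χ (1, -1) = 0 := by
    rw [show ((1, -1) : ZMod m × ZMod n) = (1, 0) - (0, 1) by ext <;> simp, map_sub, hχ₁, hχ₂,
      sub_self]
  refine (h.out (h.north_right hN)).resolve_left fun hE => ?_
  obtain ⟨t, ht⟩ := hv
  -- As before, with the pattern "`w` north, `w + (0, 1)` east". The obstruction is now at the even
  -- vertex `w + (1, 0)`, hence only `(0, 0)` or `(1, 1)`.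
  have key : ∀ s : ℕ, χ (v + s • ((1, -1) : ZMod m × ZMod n)) = 1 ∧
      N (v + s • ((1, -1) : ZMod m × ZMod n)) ∧
      E (v + s • ((1, -1) : ZMod m × ZMod n) + (0, 1)) := by
    intro s
    induction s with
    | zero => simpa using ⟨hodd, hN, hE⟩
    | succ s ih =>
      rw [succ_nsmul, ← add_assoc]
      obtain ⟨h0, h1, h2⟩ := ih
      generalize v + s • ((1, -1) : ZMod m × ZMod n) = w at h0 h1 h2
      have h0' : χ (w + (1, 0)) = 0 := by rw [map_add, h0, hχ₁]; decide
      have h3 : w + (1, 0) ∉ rectangle m n 2 2 := by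
        rw [mem_rectangle_two]
        rintro (h3 | h3 | h3 | h3)
        · apply h.east_right h2
          rw [add_right_comm, h3, mem_rectangle_two]
          simp
        · rw [h3, hχ₁] at h0'
          exact absurd h0' (by decide)
        · rw [h3, hχ₂] at h0'
          exact absurd h0' (by decide)
        · apply h.north_left h1
          rw [eq_sub_of_add_eq h3, mem_rectangle_two]
          simp
      refine ⟨by rw [map_add, h0, hχ₃, add_zero], h.north_succ h1 h3, ?_⟩
      rw [add_right_comm]
      apply h.east_succ h2
      rwa [add_assoc, show ((0, 1) : ZMod m × ZMod n) + (1, -1) = (1, 0) by simp]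
  apply h.north_left (key t).2.1
  rw [ht, mem_rectangle_two]
  simp

end IsCover

/-- With `v = (x, y)`, the congruences `t ≡ -x` mod `m` and `t ≡ y - 1` mod `n` are compatible
modulo the gcd 2 exactly when `x + y` is odd. -/
theorem exists_nsmul_antidiag {m n : ℕ} (hm : 0 < m) (hn : 0 < n) (hg : Nat.gcd m n = 2)
    (χ : ZMod m × ZMod n →+ ZMod 2) (hχ₁ : χ (1, 0) = 1) (hχ₂ : χ (0, 1) = 1)
    {v : ZMod m × ZMod n} (hodd : χ v = 1) :
    ∃ t : ℕ, v + t • ((1, -1) : ZMod m × ZMod n) = (0, 1) := by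
  have : NeZero m := ⟨hm.ne'⟩
  have : NeZero n := ⟨hn.ne'⟩
  obtain ⟨x, y⟩ := v
  have hxy : ((x, y) : ZMod m × ZMod n) = x.val • (1, 0) + y.val • (0, 1) := by
    ext <;> simp
  rw [hxy, map_add, map_nsmul, map_nsmul, hχ₁, hχ₂, nsmul_one, nsmul_one] at hodd
  have hsum : x.val + y.val ≡ 1 [MOD 2] := by
    rw [← ZMod.natCast_eq_natCast_iff]
    exact_mod_cast hodd
  have hm2 : 2 ∣ m := hg ▸ Nat.gcd_dvd_left m n
  have hn2 : 2 ∣ n := hg ▸ Nat.gcd_dvd_right m n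
  have hx := x.val_lt
  have hpar : m - x.val ≡ y.val + n - 1 [MOD Nat.gcd m n] := by
    rw [hg]
    have : (x.val + y.val) % 2 = 1 := hsum
    unfold Nat.ModEq
    omega
  obtain ⟨t, h1, h2⟩ := Nat.chineseRemainder' hpar
  refine ⟨t, ?_⟩
  rw [← ZMod.natCast_eq_natCast_iff] at h1 h2
  rw [Nat.cast_sub hx.le] at h1
  rw [Nat.cast_sub (by omega)] at h2
  push_cast at h1 h2
  ext
  · simp [h1]
  · simp [h2]

/-- Two equal steps from an odd vertex lead to an odd vertex with the same parity `X` of the first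
coordinate. The odd vertices `(0, -1)` and `(-1, 0)` differ in `X`, so no single cycle contains
both. -/
theorem gcd_ne_two_of_cycle {m n k : ℕ} (hm : 3 ≤ m) (hn : 3 ≤ n) (hk : 0 < k)
    {c : ZMod k → {v : ZMod m × ZMod n // v ∉ rectangle m n 2 2}} (hc : Function.Bijective c)
    (hadj : ∀ i, (deleteVerts (boxProd (directedCycle m) (directedCycle n))
      (rectangle m n 2 2)).Adj (c i) (c (i + 1))) : Nat.gcd m n ≠ 2 := by
  intro hg
  have : NeZero k := ⟨hk.ne'⟩
  have hm2 : 2 ∣ m := hg ▸ Nat.gcd_dvd_left m n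
  have hn2 : 2 ∣ n := hg ▸ Nat.gcd_dvd_right m n
  obtain ⟨-, -, m3, m4, m5⟩ := two_ne_zero_one hm
  obtain ⟨-, -, n3, n4, n5⟩ := two_ne_zero_one hn
  set X : ZMod m × ZMod n →+ ZMod 2 :=
    ((ZMod.castHom hm2 (ZMod 2)).toAddMonoidHom).comp (AddMonoidHom.fst _ _) with hX
  set χ : ZMod m × ZMod n →+ ZMod 2 :=
    X + ((ZMod.castHom hn2 (ZMod 2)).toAddMonoidHom).comp (AddMonoidHom.snd _ _) with hχ
  have hχ₁ : χ (1, 0) = 1 := by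
    simp only [hχ, hX, AddMonoidHom.add_apply, AddMonoidHom.comp_apply, AddMonoidHom.coe_fst,
      AddMonoidHom.coe_snd, RingHom.toAddMonoidHom_eq_coe, AddMonoidHom.coe_coe, map_one, map_zero,
      add_zero]
  have hχ₂ : χ (0, 1) = 1 := by
    simp only [hχ, hX, AddMonoidHom.add_apply, AddMonoidHom.comp_apply, AddMonoidHom.coe_fst,
      AddMonoidHom.coe_snd, RingHom.toAddMonoidHom_eq_coe, AddMonoidHom.coe_coe, map_one, map_zero,
      zero_add]
  have hX₁ : X (1, 0) = 1 := by
    simp only [hX, AddMonoidHom.comp_apply, AddMonoidHom.coe_fst,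
      RingHom.toAddMonoidHom_eq_coe, AddMonoidHom.coe_coe, map_one]
  have hX₂ : X (0, 1) = 0 := by simp [hX]
  have hcov := isCover_of_cycle hm hc hadj
  have hinj : ∀ {i j}, (c i).1 = (c j).1 → i = j := fun h => hc.1 (Subtype.ext h)
  have two : (1 : ZMod 2) + 1 = 0 := by decide
  have hstep : ∀ i, χ (c i).1 = 1 →
      χ (c (i + 1 + 1)).1 = 1 ∧ X (c (i + 1 + 1)).1 = X (c i).1 := by
    intro i hi
    have ht := exists_nsmul_antidiag (by omega) (by omega) hg χ hχ₁ hχ₂ hi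
    rcases hcov.out (c i).2 with hE | hN
    · obtain ⟨j, hj, hj'⟩ := hcov.east_east hn χ hχ₁ hχ₂ hi hE ht
      obtain ⟨i', hi', hi''⟩ := hE
      obtain rfl := hinj hi'
      rw [← hi''] at hj
      obtain rfl := hinj hj
      rw [hj', map_add, map_add, map_add, map_add, hχ₁, hX₁, hi, add_assoc, add_assoc, two]
      simp
    · obtain ⟨j, hj, hj'⟩ := hcov.north_north χ hχ₁ hχ₂ hi hN ht
      obtain ⟨i', hi', hi''⟩ := hN
      obtain rfl := hinj hi'
      rw [← hi''] at hj
      obtain rfl := hinj hj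
      rw [hj', map_add, map_add, map_add, map_add, hχ₂, hX₂, hi, add_assoc, add_assoc, two]
      simp
  have hχstep : ∀ i, χ (c (i + 1)).1 = χ (c i).1 + 1 := by
    intro i
    rcases hcov.out (c i).2 with hE | hE <;>
    · obtain ⟨i', hi', hi''⟩ := hE
      obtain rfl := hinj hi'
      rw [hi'', map_add]
      simp only [hχ₁, hχ₂]
  have hA : ((0, -1) : ZMod m × ZMod n) ∉ rectangle m n 2 2 := by
    rw [mem_rectangle_two]; simp [n4, n5]
  have hB : ((-1, 0) : ZMod m × ZMod n) ∉ rectangle m n 2 2 := by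
    rw [mem_rectangle_two]; simp [m4, m5]
  have hA' : ((0, -1) : ZMod m × ZMod n) = -(0, 1) := by simp
  have hB' : ((-1, 0) : ZMod m × ZMod n) = -(1, 0) := by simp
  rw [hA'] at hA
  rw [hB'] at hB
  obtain ⟨i₀, hi₀⟩ := hc.2 ⟨_, hA⟩
  obtain ⟨j₀, hj₀⟩ := hc.2 ⟨_, hB⟩
  have hχA : χ (c i₀).1 = 1 := by rw [hi₀, map_neg, hχ₂]; decide
  have hχB : χ (c j₀).1 = 1 := by rw [hj₀, map_neg, hχ₁]; decide
  have hXA : X (c i₀).1 = 0 := by rw [hi₀, map_neg, hX₂]; decide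
  have hXB : X (c j₀).1 = 1 := by rw [hj₀, map_neg, hX₁]; decide
  have key : ∀ s : ℕ, (χ (c (i₀ + s)).1 = 1 ∧ X (c (i₀ + s)).1 = 0) ∨
      (χ (c (i₀ + s)).1 = 0 ∧ χ (c (i₀ + s + 1)).1 = 1 ∧ X (c (i₀ + s + 1)).1 = 0) := by
    intro s
    induction s with
    | zero => left; simpa using ⟨hχA, hXA⟩
    | succ s ih =>
      push_cast
      rw [← add_assoc]
      rcases ih with ⟨h1, h2⟩ | ⟨-, h⟩
      · right
        have := hstep _ h1
        exact ⟨by rw [hχstep, h1, two], this.1, this.2.trans h2⟩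
      · exact Or.inl h
  have := key (j₀ - i₀).val
  rw [ZMod.natCast_zmod_val, add_sub_cancel, hχB, hXB] at this
  simp at this

/-! ### The coprime case: rotations and coordinates on the antidiagonal -/

/-- If the only possible successor function of a hamiltonian cycle is conjugate to the rotation
`j ↦ j + r` of `ZMod K`, then there is a hamiltonian cycle if and only if `r` is prime to `K`. -/
theorem isHamiltonian_iff_coprime {V : Type*} {X : Digraph V} {K r : ℕ} (hK : 0 < K)
    {φ : ZMod K → V} (hφ : Function.Bijective φ) (hadj : ∀ j, X.Adj (φ j) (φ (j + r)))
    (hstep : ∀ (k : ℕ) (c : ZMod k → V), Function.Bijective c → (∀ i, X.Adj (c i) (c (i + 1))) →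
      ∀ i j, c i = φ j → c (i + 1) = φ (j + r)) :
    IsHamiltonian X ↔ Nat.Coprime r K := by
  rw [← ZMod.isUnit_iff_coprime]
  constructor
  · rintro ⟨k, hk, c, hc, hca⟩
    have : NeZero k := ⟨hk.ne'⟩
    obtain ⟨j, hj⟩ := hφ.2 (c 0)
    have key : ∀ s : ℕ, c s = φ (j + s * r) := by
      intro s
      induction s with
      | zero => simp [hj]
      | succ s ih =>
        push_cast
        rw [hstep k c hc hca _ _ ih]
        ring_nf
    obtain ⟨i, hi⟩ := hc.2 (φ (j + 1))
    have h1 := key i.val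
    rw [ZMod.natCast_zmod_val, hi] at h1
    have h2 := add_left_cancel (hφ.1 h1)
    exact IsUnit.of_mul_eq_one (i.val : ZMod K) (by rw [mul_comm]; exact h2.symm)
  · intro hr
    refine ⟨K, hK, fun i => φ (i * r), hφ.comp ?_, fun i => ?_⟩
    · obtain ⟨u, hu⟩ := hr
      rw [← hu]
      exact Units.mulRight_bijective u
    · have := hadj (i * r)
      rwa [← add_one_mul] at this

theorem antidiag_surjective {m n : ℕ} (hm : 0 < m) (hn : 0 < n) (hg : Nat.gcd m n = 1)
    (v : ZMod m × ZMod n) : ∃ t : ℤ, 0 ≤ t ∧ t < m * n ∧ antidiag m n t = v := by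
  have : NeZero m := ⟨hm.ne'⟩
  have : NeZero n := ⟨hn.ne'⟩
  obtain ⟨t, h1, h2⟩ := Nat.chineseRemainder hg v.1.val (-v.2).val
  have hmn : 0 < m * n := Nat.mul_pos hm hn
  refine ⟨((t % (m * n) : ℕ) : ℤ), by positivity, by exact_mod_cast Nat.mod_lt _ hmn, ?_⟩
  have h1' := ((Nat.mod_modEq t (m * n)).of_mul_right n).trans h1
  have h2' := ((Nat.mod_modEq t (m * n)).of_mul_left m).trans h2
  rw [← ZMod.natCast_eq_natCast_iff, ZMod.natCast_zmod_val] at h1' h2'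
  ext
  · simpa only [antidiag, Int.cast_natCast] using h1'
  · simp only [antidiag, Int.cast_neg, Int.cast_natCast, h2', neg_neg]

theorem antidiag_eq_iff {m n : ℕ} (hg : Nat.gcd m n = 1) {s t : ℤ} :
    antidiag m n s = antidiag m n t ↔ (m * n : ℤ) ∣ t - s := by
  have h1 : ((s : ZMod m) = (t : ZMod m)) ↔ (m : ℤ) ∣ t - s :=
    ZMod.intCast_eq_intCast_iff_dvd_sub s t m
  have h2 : (((-s : ℤ) : ZMod n) = ((-t : ℤ) : ZMod n)) ↔ (n : ℤ) ∣ t - s := by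
    rw [← ZMod.intCast_eq_intCast_iff_dvd_sub s t n]
    push_cast
    exact neg_inj
  simp only [antidiag, Prod.mk.injEq, h1, h2]
  constructor
  · rintro ⟨h, h'⟩
    exact (Nat.isCoprime_iff_coprime.mpr hg).mul_dvd h h'
  · intro h
    exact ⟨(dvd_mul_right _ _).trans h, (dvd_mul_left _ _).trans h⟩

/-- The parametrization of the torus by the antidiagonal walk, together with the residue `e` that
is `1` modulo `m` and `0` modulo `n`. -/
structure IsIdempotent (m n : ℕ) (k l e : ℤ) : Prop where
  three_le_left : 3 ≤ m
  three_le_right : 3 ≤ n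
  gcd_eq_one : Nat.gcd m n = 1
  eq_left : e = m * k + 1
  eq_right : e = n * l
  pos : 1 ≤ e
  le : e ≤ m * n

namespace IsIdempotent

variable {m n : ℕ} {k l e : ℤ}

theorem three_le (H : IsIdempotent m n k l e) : 3 ≤ e := by
  have h1 := H.three_le_right
  have h2 := H.pos
  have h3 := H.eq_right
  have : (n : ℤ) ≤ e := Int.le_of_dvd (by omega) ⟨l, h3⟩
  omega

theorem add_two_le (H : IsIdempotent m n k l e) : e + 2 ≤ m * n := by
  have h1 := H.three_le_left
  have h2 := H.le
  have h3 := H.eq_left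
  have h5 : m * k < m * n := by omega
  have h6 : k < n := lt_of_mul_lt_mul_left h5 (by omega)
  have h7 : (m : ℤ) * (k + 1) ≤ m * n := by gcongr; omega
  linarith [show (3 : ℤ) ≤ m by omega]

/-- Since `n ≥ 3` divides `e`, multiples of `e` avoid 1 and 2 modulo `mn`; this rules out the
boundary cases of later inequalities. -/
theorem ne_one (H : IsIdempotent m n k l e) (i j : ℤ) : i * e ≠ j * (m * n) + 1 := by
  intro h
  have : (n : ℤ) ∣ 1 := ⟨i * l - j * m, by linear_combination i * H.eq_right - h⟩
  have := Int.le_of_dvd one_pos this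
  have := H.three_le_right
  omega

theorem ne_two (H : IsIdempotent m n k l e) (i j : ℤ) : i * e ≠ j * (m * n) + 2 := by
  intro h
  have : (n : ℤ) ∣ 2 := ⟨i * l - j * m, by linear_combination i * H.eq_right - h⟩
  have := Int.le_of_dvd two_pos this
  have := H.three_le_right
  omega

theorem two_mul_ne (H : IsIdempotent m n k l e) : 2 * e ≠ m * n := by
  intro h
  have : (m : ℤ) ∣ 2 := ⟨n - 2 * k, by linear_combination h - 2 * H.eq_left⟩
  have := Int.le_of_dvd two_pos this
  have := H.three_le_left
  omega

theorem east (H : IsIdempotent m n k l e) (t : ℤ) :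
    antidiag m n (t + e) = antidiag m n t + (1, 0) := by
  ext
  · simp [antidiag, H.eq_left]
  · simp [antidiag, H.eq_right]

theorem north (H : IsIdempotent m n k l e) (t : ℤ) :
    antidiag m n (t + e - 1) = antidiag m n t + (0, 1) := by
  ext
  · simp [antidiag, H.eq_left]
  · simp only [antidiag, Prod.snd_add]
    rw [H.eq_right]
    push_cast
    simp only [CharP.cast_eq_zero, zero_mul]
    ring

theorem sub_period (H : IsIdempotent m n k l e) (t : ℤ) :
    antidiag m n (t - m * n) = antidiag m n t := by
  rw [antidiag_eq_iff H.gcd_eq_one]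
  exact ⟨1, by ring⟩

theorem mem_iff_dvd (H : IsIdempotent m n k l e) (t : ℤ) :
    antidiag m n t ∈ rectangle m n 2 2 ↔ (m * n : ℤ) ∣ t ∨ (m * n : ℤ) ∣ t - (e - 1) ∨
      (m * n : ℤ) ∣ t - e ∨ (m * n : ℤ) ∣ t - (2 * e - 1) := by
  have h0 : ((0, 0) : ZMod m × ZMod n) = antidiag m n 0 := by simp [antidiag]
  have h1 : ((1, 0) : ZMod m × ZMod n) = antidiag m n (0 + e) := by
    rw [H.east, ← h0]; simp
  have h2 : ((0, 1) : ZMod m × ZMod n) = antidiag m n (0 + e - 1) := by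
    rw [H.north, ← h0]; simp
  have h3 : ((1, 1) : ZMod m × ZMod n) = antidiag m n (0 + e + e - 1) := by
    rw [H.north, ← h1]; simp
  rw [mem_rectangle_two, h0, h1, h2, h3]
  simp only [antidiag_eq_iff H.gcd_eq_one]
  rw [dvd_sub_comm, dvd_sub_comm (b := 0 + e), dvd_sub_comm (b := 0 + e - 1),
    dvd_sub_comm (b := 0 + e + e - 1), sub_zero, zero_add, ← two_mul]
  tauto

/-- Two periods are covered so that `t + e` need not be reduced; the quotient by `mn` is then -1, 0
or 1. -/
theorem mem_iff (H : IsIdempotent m n k l e) {t : ℤ} (h0 : 0 ≤ t) (h1 : t < 2 * (m * n)) :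
    antidiag m n t ∈ rectangle m n 2 2 ↔
      t = 0 ∨ t = m * n ∨ t = e - 1 ∨ t = e - 1 + m * n ∨ t = e ∨ t = e + m * n ∨
        t = 2 * e - 1 ∨ t = 2 * e - 1 + m * n ∨ t = 2 * e - 1 - m * n := by
  have h2 := H.three_le
  have h3 := H.add_two_le
  rw [H.mem_iff_dvd]
  generalize (m * n : ℤ) = M at *
  constructor
  · rintro (⟨x, hx⟩ | ⟨x, hx⟩ | ⟨x, hx⟩ | ⟨x, hx⟩)
    all_goals
      have hx1 : -2 < x := by nlinarith
      have hx2 : x < 2 := by nlinarith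
      interval_cases x <;> omega
  · rintro (h | h | h | h | h | h | h | h | h)
    · exact Or.inl ⟨0, by linarith⟩
    · exact Or.inl ⟨1, by linarith⟩
    · exact Or.inr (Or.inl ⟨0, by linarith⟩)
    · exact Or.inr (Or.inl ⟨1, by linarith⟩)
    · exact Or.inr (Or.inr (Or.inl ⟨0, by linarith⟩))
    · exact Or.inr (Or.inr (Or.inl ⟨1, by linarith⟩))
    · exact Or.inr (Or.inr (Or.inr ⟨0, by linarith⟩))
    · exact Or.inr (Or.inr (Or.inr ⟨1, by linarith⟩))
    · exact Or.inr (Or.inr (Or.inr ⟨-1, by linarith⟩))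

end IsIdempotent

namespace IsCover

variable {m n : ℕ} {E N : ZMod m × ZMod n → Prop} {k l e : ℤ}

theorem east_range (h : IsCover m n E N) {s u : ℤ} (hs : E (antidiag m n s))
    (hR : ∀ t, s < t → t ≤ u → antidiag m n t ∉ rectangle m n 2 2) :
    ∀ t, s ≤ t → t ≤ u → E (antidiag m n t) := by
  intro t hst
  induction t, hst using Int.leInduction with
  | base => exact fun _ => hs
  | succ t ht ih =>
    intro htu
    have := hR (t + 1) (by omega) htu
    rw [antidiag_succ] at this ⊢
    exact h.east_succ (ih (by omega)) this

/-- A north run from `t` to `t + 1` is interrupted only when their common target `t + e` is deleted,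
whereas an east run is interrupted by the deletion of `t + 1` itself. -/
theorem north_range (h : IsCover m n E N) (H : IsIdempotent m n k l e) {s u : ℤ}
    (hs : N (antidiag m n s))
    (hR : ∀ t, s ≤ t → t < u → antidiag m n (t + e) ∉ rectangle m n 2 2) :
    ∀ t, s ≤ t → t ≤ u → N (antidiag m n t) := by
  intro t hst
  induction t, hst using Int.leInduction with
  | base => exact fun _ => hs
  | succ t ht ih =>
    intro htu
    have := hR t ht (by omega)
    rw [H.east] at this
    rw [antidiag_succ]
    exact h.north_succ (ih (by omega)) this

end IsCover

/-- A criterion for hamiltonicity: `p` enumerates the complement of the rectangle, and every cover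
acts on it as the rotation by `r`. -/
theorem IsIdempotent.isHamiltonian_iff {m n : ℕ} {k l e : ℤ} (H : IsIdempotent m n k l e)
    {K r : ℕ} (hK : 0 < K) {p q : ℤ → ℤ}
    (hp : ∀ j : ℤ, 0 ≤ j → j < K → 0 ≤ p j ∧ p j < m * n ∧ q (p j) = j ∧
      antidiag m n (p j) ∉ rectangle m n 2 2)
    (hq : ∀ t : ℤ, 0 ≤ t → t < m * n → antidiag m n t ∉ rectangle m n 2 2 →
      0 ≤ q t ∧ q t < K ∧ p (q t) = t)
    (hr : ∀ j j' : ℤ, 0 ≤ j → j < K → 0 ≤ j' → j' < K → (j' = j + r ∨ j' = j + r - K) →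
      (antidiag m n (p j') = antidiag m n (p j) + (1, 0) ∧
        ∀ E N, IsCover m n E N → E (antidiag m n (p j))) ∨
      (antidiag m n (p j') = antidiag m n (p j) + (0, 1) ∧
        ∀ E N, IsCover m n E N → N (antidiag m n (p j))))
    (hrK : r < K) :
    IsHamiltonian (deleteVerts (boxProd (directedCycle m) (directedCycle n))
      (rectangle m n 2 2)) ↔ Nat.Coprime r K := by
  have : NeZero K := ⟨hK.ne'⟩
  have hm := H.three_le_left
  have hn := H.three_le_right
  have hlt : ∀ j : ZMod K, (0 : ℤ) ≤ j.val ∧ (j.val : ℤ) < K := fun j =>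
    ⟨by positivity, by exact_mod_cast j.val_lt⟩
  have hmod : ∀ j : ZMod K, ((j + r).val : ℤ) = j.val + r ∨
      ((j + r).val : ℤ) = j.val + r - K := by
    intro j
    have h1 := j.val_lt
    rw [ZMod.val_add, ZMod.val_natCast, Nat.mod_eq_of_lt hrK]
    by_cases h : j.val + r < K
    · rw [Nat.mod_eq_of_lt h]; left; push_cast; rfl
    · rw [Nat.mod_eq_sub_mod (by omega), Nat.mod_eq_of_lt (by omega)]
      omega
  have hstep := fun j : ZMod K => hr (j.val : ℤ) ((j + r).val : ℤ) (hlt _).1 (hlt _).2 (hlt _).1 (hlt _).2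
    (hmod j)
  refine isHamiltonian_iff_coprime hK
    (φ := fun j => ⟨antidiag m n (p j.val), (hp (j.val : ℤ) (hlt j).1 (hlt j).2).2.2.2⟩) ⟨?_, ?_⟩ ?_ ?_
  · intro i j hij
    obtain ⟨i1, i2, i3, -⟩ := hp _ (hlt i).1 (hlt i).2
    obtain ⟨j1, j2, j3, -⟩ := hp _ (hlt j).1 (hlt j).2
    have h1 := (antidiag_eq_iff H.gcd_eq_one).1 (congrArg Subtype.val hij)
    have h2 : p j.val - p i.val = 0 := by
      apply Int.eq_zero_of_abs_lt_dvd h1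
      rw [abs_lt]
      constructor <;> linarith
    rw [← sub_eq_zero.1 h2, j3] at i3
    exact ZMod.val_injective K (by exact_mod_cast i3.symm)
  · rintro ⟨v, hv⟩
    obtain ⟨t, t0, t1, rfl⟩ := antidiag_surjective (by omega) (by omega) H.gcd_eq_one v
    obtain ⟨q0, q1, q2⟩ := hq t t0 t1 hv
    refine ⟨((q t).toNat : ZMod K), Subtype.ext ?_⟩
    simp only
    rw [ZMod.val_natCast, Nat.mod_eq_of_lt (by omega), Int.toNat_of_nonneg q0, q2]
  · intro j
    rcases hstep j with ⟨h, -⟩ | ⟨h, -⟩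
    · exact Or.inr ⟨by simp only [h, Prod.snd_add, add_zero],
        by simp only [h, directedCycle, Prod.fst_add]⟩
    · exact Or.inl ⟨by simp only [h, Prod.fst_add, add_zero],
        by simp only [h, directedCycle, Prod.snd_add]⟩
  · intro c' c hc hca i j hij
    have hcov := isCover_of_cycle hm hc hca
    have hinj : ∀ {i j}, (c i).1 = (c j).1 → i = j := fun h => hc.1 (Subtype.ext h)
    apply Subtype.ext
    rcases hstep j with ⟨h, h'⟩ | ⟨h, h'⟩
    · obtain ⟨i', h1, h2⟩ := h' _ _ hcov
      obtain rfl : i' = i := hinj (by rw [h1, hij])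
      rw [h2]; exact h.symm
    · obtain ⟨i', h1, h2⟩ := h' _ _ hcov
      obtain rfl : i' = i := hinj (by rw [h1, hij])
      rw [h2]; exact h.symm

/-! ### Forced directions in the coprime case -/

namespace IsCover

variable {m n : ℕ} {E N : ZMod m × ZMod n → Prop} {k l e : ℤ}

theorem east_of_add_mem (h : IsCover m n E N) (H : IsIdempotent m n k l e) {t : ℤ}
    (h1 : antidiag m n t ∉ rectangle m n 2 2)
    (h2 : antidiag m n (t + e - 1) ∈ rectangle m n 2 2) : E (antidiag m n t) :=
  h.east_of_mem h1 (H.north t ▸ h2)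

theorem north_of_sub_mem (h : IsCover m n E N) (H : IsIdempotent m n k l e) {t : ℤ}
    (h1 : antidiag m n (t - 1) ∈ rectangle m n 2 2)
    (h2 : antidiag m n (t - 1 + e) ∉ rectangle m n 2 2) : N (antidiag m n t) := by
  rw [H.east] at h2
  have := h.north_of_pred_mem h1 h2
  rwa [← antidiag_succ, sub_add_cancel] at this

/-- Otherwise the north run starting at `e + 1`, just past the hole, reaches `2e - 2`, which must go
east because the other in-neighbour `2e - 1` of its east target is deleted. -/
theorem lt_three_mul (h : IsCover m n E N) (H : IsIdempotent m n k l e) (h2 : 2 * e < m * n) :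
    m * n + 1 < 3 * e := by
  have f1 := H.three_le
  have f2 := H.add_two_le
  have f3 := H.ne_one 3 1
  by_contra! hlt
  have hN := h.north_range H (s := e + 1) (u := 2 * e - 2)
    (h.north_of_sub_mem H (by rw [H.mem_iff (by omega) (by omega)]; omega)
      (by rw [H.mem_iff (by omega) (by omega)]; omega))
    (fun t _ _ => by rw [H.mem_iff (by omega) (by omega)]; omega) (2 * e - 2) (by omega) le_rfl
  refine h.out_unique (h.east_of_succ_mem ?_ ?_) hN
  · rw [← antidiag_succ, H.mem_iff (by omega) (by omega)]
    omega
  · rw [← H.east, H.mem_iff (by omega) (by omega)]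
    omega

/-- Otherwise the east run starting at `1` reaches `mn - e` before the deleted `2e - 1 - mn`, and
its next arc enters `mn ≡ 0`. -/
theorem three_mul_lt (h : IsCover m n E N) (H : IsIdempotent m n k l e) (h2 : m * n < 2 * e) :
    3 * e < 2 * (m * n) + 2 := by
  have f1 := H.three_le
  have f2 := H.add_two_le
  have f3 := H.ne_one 2 1
  have f4 := H.ne_two 2 1
  by_contra! hlt
  have hE := h.east_range (s := 1) (u := m * n - e)
    (h.east_of_add_mem H (by rw [H.mem_iff (by omega) (by omega)]; omega)
      (by rw [H.mem_iff (by omega) (by omega)]; omega))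
    (fun t _ _ => by rw [H.mem_iff (by omega) (by omega)]; omega) (m * n - e) (by omega) le_rfl
  apply h.east_right hE
  rw [← H.east, H.mem_iff (by omega) (by omega)]
  omega

/-- The types of all the vertices, when `2 e < m n`. -/
theorem types_of_lt (h : IsCover m n E N) (H : IsIdempotent m n k l e) (h2 : 2 * e < m * n)
    (h3 : m * n + 1 < 3 * e) :
    (∀ t, 1 ≤ t → t ≤ e - 2 → E (antidiag m n t)) ∧
    (∀ t, e + 1 ≤ t → t ≤ m * n - e → N (antidiag m n t)) ∧
    (∀ t, m * n - e + 1 ≤ t → t ≤ 2 * e - 2 → E (antidiag m n t)) ∧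
    (∀ t, 2 * e ≤ t → t ≤ m * n - 1 → N (antidiag m n t)) := by
  have f1 := H.three_le
  have f2 := H.add_two_le
  have f3 := H.ne_two 3 1
  -- East runs start where the north target is deleted: `1` and `mn - e + 1` have north targets `e`
  -- and `mn`. North runs start right after the deleted `e` and `2e - 1`, whose east targets remain.
  refine ⟨?_, ?_, ?_, ?_⟩
  · exact h.east_range
      (h.east_of_add_mem H (by rw [H.mem_iff (by omega) (by omega)]; omega)
        (by rw [H.mem_iff (by omega) (by omega)]; omega))
      (fun t _ _ => by rw [H.mem_iff (by omega) (by omega)]; omega)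
  · exact h.north_range H
      (h.north_of_sub_mem H (by rw [H.mem_iff (by omega) (by omega)]; omega)
        (by rw [H.mem_iff (by omega) (by omega)]; omega))
      (fun t _ _ => by rw [H.mem_iff (by omega) (by omega)]; omega)
  · exact h.east_range
      (h.east_of_add_mem H (by rw [H.mem_iff (by omega) (by omega)]; omega)
        (by rw [H.mem_iff (by omega) (by omega)]; omega))
      (fun t _ _ => by rw [H.mem_iff (by omega) (by omega)]; omega)
  · exact h.north_range H
      (h.north_of_sub_mem H (by rw [H.mem_iff (by omega) (by omega)]; omega)
        (by rw [H.mem_iff (by omega) (by omega)]; omega))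
      (fun t _ _ => by rw [H.mem_iff (by omega) (by omega)]; omega)

/-- The types of all the vertices, when `m n < 2 e`. -/
theorem types_of_gt (h : IsCover m n E N) (H : IsIdempotent m n k l e) (h2 : m * n < 2 * e)
    (h3 : 3 * e < 2 * (m * n) + 2) :
    (∀ t, 1 ≤ t → t ≤ 2 * e - 2 - m * n → E (antidiag m n t)) ∧
    (∀ t, 2 * e - m * n ≤ t → t ≤ m * n - e → N (antidiag m n t)) ∧
    (∀ t, m * n - e + 1 ≤ t → t ≤ e - 2 → E (antidiag m n t)) ∧
    (∀ t, e + 1 ≤ t → t ≤ m * n - 1 → N (antidiag m n t)) := by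
  have f1 := H.three_le
  have f2 := H.add_two_le
  have f3 := H.ne_one 2 1
  have f4 := H.ne_two 2 1
  have f5 := H.ne_one 3 2
  -- The deleted vertex `2e - 1` now reduces to `2e - 1 - mn`, which lies below `e - 1`, so the runs
  -- occur in a different place.
  refine ⟨?_, ?_, ?_, ?_⟩
  · exact h.east_range
      (h.east_of_add_mem H (by rw [H.mem_iff (by omega) (by omega)]; omega)
        (by rw [H.mem_iff (by omega) (by omega)]; omega))
      (fun t _ _ => by rw [H.mem_iff (by omega) (by omega)]; omega)
  · exact h.north_range H
      (h.north_of_sub_mem H (by rw [H.mem_iff (by omega) (by omega)]; omega)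
        (by rw [H.mem_iff (by omega) (by omega)]; omega))
      (fun t _ _ => by rw [H.mem_iff (by omega) (by omega)]; omega)
  · exact h.east_range
      (h.east_of_add_mem H (by rw [H.mem_iff (by omega) (by omega)]; omega)
        (by rw [H.mem_iff (by omega) (by omega)]; omega))
      (fun t _ _ => by rw [H.mem_iff (by omega) (by omega)]; omega)
  · exact h.north_range H
      (h.north_of_sub_mem H (by rw [H.mem_iff (by omega) (by omega)]; omega)
        (by rw [H.mem_iff (by omega) (by omega)]; omega))
      (fun t _ _ => by rw [H.mem_iff (by omega) (by omega)]; omega)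

end IsCover

/-! ### The successor map as a rotation -/

namespace IsIdempotent

variable {m n : ℕ} {k l e : ℤ}

theorem antidiag_east (H : IsIdempotent m n k l e) {s t : ℤ}
    (h : s = t + e ∨ s = t + e - m * n) : antidiag m n s = antidiag m n t + (1, 0) := by
  rcases h with rfl | rfl
  · exact H.east t
  · rw [H.sub_period, H.east]

theorem antidiag_north (H : IsIdempotent m n k l e) {s t : ℤ}
    (h : s = t + e - 1 ∨ s = t + e - 1 - m * n) : antidiag m n s = antidiag m n t + (0, 1) := by
  rcases h with rfl | rfl
  · exact H.north t
  · rw [H.sub_period, H.north]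

theorem isHamiltonian_iff_of_lt (H : IsIdempotent m n k l e) (h2 : 2 * e < m * n)
    (h3 : m * n + 1 < 3 * e) {K r : ℕ} (hK : (K : ℤ) = m * n - 4) (hr : (r : ℤ) = e - 2) :
    IsHamiltonian (deleteVerts (boxProd (directedCycle m) (directedCycle n))
      (rectangle m n 2 2)) ↔ Nat.Coprime r K := by
  have f1 := H.three_le
  have f2 := H.add_two_le
  -- `p` lists the remaining vertices in increasing order, skipping `0`, the pair `e - 1, e`, and
  -- `2e - 1`; `q` is its inverse there. Modulo `K`, an east arc (shift `e`) skips two deleted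
  -- vertices and a north arc (shift `e - 1`) skips one, so both become a shift by `e - 2`.
  obtain ⟨p, hp⟩ : ∃ p : ℤ → ℤ, ∀ j, p j =
      if j < e - 2 then j + 1 else if j < 2 * e - 4 then j + 3 else j + 4 := ⟨_, fun _ => rfl⟩
  obtain ⟨q, hq⟩ : ∃ q : ℤ → ℤ, ∀ t, q t =
      if t < e then t - 1 else if t < 2 * e then t - 3 else t - 4 := ⟨_, fun _ => rfl⟩
  refine H.isHamiltonian_iff (by omega) (p := p) (q := q) ?_ ?_ ?_ (by omega)
  · intro j j0 j1
    have b0 : 0 ≤ p j := by rw [hp]; split_ifs <;> omega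
    have b1 : p j < m * n := by rw [hp]; split_ifs <;> omega
    refine ⟨b0, b1, ?_, ?_⟩
    · rw [hq, hp]
      split_ifs <;> omega
    · rw [H.mem_iff b0 (by omega), hp]
      split_ifs <;> omega
  · intro t t0 t1 ht
    rw [H.mem_iff t0 (by omega)] at ht
    rw [hp, hq]
    split_ifs <;> omega
  · intro j j' j0 j1 j0' j1' hj
    rcases lt_or_ge j (e - 2) with c1 | c1
    · left
      have hpj : p j = j + 1 := by rw [hp, if_pos c1]
      rw [hpj]
      exact ⟨H.antidiag_east (by rw [hp]; split_ifs <;> omega), fun E N hc =>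
        (hc.types_of_lt H h2 h3).1 _ (by omega) (by omega)⟩
    rcases lt_or_ge j (2 * e - 4) with c2 | c2
    · have hpj : p j = j + 3 := by rw [hp]; split_ifs <;> omega
      rw [hpj]
      rcases le_or_gt (j + 3) (m * n - e) with c3 | c3
      · right
        exact ⟨H.antidiag_north (by rw [hp]; split_ifs <;> omega), fun E N hc =>
          (hc.types_of_lt H h2 h3).2.1 _ (by omega) (by omega)⟩
      · left
        exact ⟨H.antidiag_east (by rw [hp]; split_ifs <;> omega), fun E N hc =>
          (hc.types_of_lt H h2 h3).2.2.1 _ (by omega) (by omega)⟩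
    · right
      have hpj : p j = j + 4 := by rw [hp]; split_ifs <;> omega
      rw [hpj]
      exact ⟨H.antidiag_north (by rw [hp]; split_ifs <;> omega), fun E N hc =>
        (hc.types_of_lt H h2 h3).2.2.2 _ (by omega) (by omega)⟩

theorem isHamiltonian_iff_of_gt (H : IsIdempotent m n k l e) (h2 : m * n < 2 * e)
    (h3 : 3 * e < 2 * (m * n) + 2) {K r : ℕ} (hK : (K : ℤ) = m * n - 4) (hr : (r : ℤ) = e - 3) :
    IsHamiltonian (deleteVerts (boxProd (directedCycle m) (directedCycle n))
      (rectangle m n 2 2)) ↔ Nat.Coprime r K := by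
  have f1 := H.three_le
  have f2 := H.add_two_le
  have f3 := H.ne_one 2 1
  have f4 := H.ne_two 2 1
  -- The deleted vertices in order are now `0`, `2e - 1 - mn`, `e - 1`, `e`. An east arc skips three
  -- of them and a north arc two, whence the rotation number `e - 3`.
  obtain ⟨p, hp⟩ : ∃ p : ℤ → ℤ, ∀ j, p j =
      if j < 2 * e - 2 - m * n then j + 1 else if j < e - 3 then j + 2 else j + 4 :=
    ⟨_, fun _ => rfl⟩
  obtain ⟨q, hq⟩ : ∃ q : ℤ → ℤ, ∀ t, q t =
      if t < 2 * e - m * n then t - 1 else if t < e then t - 2 else t - 4 := ⟨_, fun _ => rfl⟩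
  refine H.isHamiltonian_iff (by omega) (p := p) (q := q) ?_ ?_ ?_ (by omega)
  · intro j j0 j1
    have b0 : 0 ≤ p j := by rw [hp]; split_ifs <;> omega
    have b1 : p j < m * n := by rw [hp]; split_ifs <;> omega
    refine ⟨b0, b1, ?_, ?_⟩
    · rw [hq, hp]
      split_ifs <;> omega
    · rw [H.mem_iff b0 (by omega), hp]
      split_ifs <;> omega
  · intro t t0 t1 ht
    rw [H.mem_iff t0 (by omega)] at ht
    rw [hp, hq]
    split_ifs <;> omega
  · intro j j' j0 j1 j0' j1' hj
    rcases lt_or_ge j (2 * e - 2 - m * n) with c1 | c1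
    · left
      have hpj : p j = j + 1 := by rw [hp, if_pos c1]
      rw [hpj]
      exact ⟨H.antidiag_east (by rw [hp]; split_ifs <;> omega), fun E N hc =>
        (hc.types_of_gt H h2 h3).1 _ (by omega) (by omega)⟩
    rcases lt_or_ge j (e - 3) with c2 | c2
    · have hpj : p j = j + 2 := by rw [hp]; split_ifs <;> omega
      rw [hpj]
      rcases le_or_gt (j + 2) (m * n - e) with c3 | c3
      · right
        exact ⟨H.antidiag_north (by rw [hp]; split_ifs <;> omega), fun E N hc =>
          (hc.types_of_gt H h2 h3).2.1 _ (by omega) (by omega)⟩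
      · left
        exact ⟨H.antidiag_east (by rw [hp]; split_ifs <;> omega), fun E N hc =>
          (hc.types_of_gt H h2 h3).2.2.1 _ (by omega) (by omega)⟩
    · right
      have hpj : p j = j + 4 := by rw [hp]; split_ifs <;> omega
      rw [hpj]
      exact ⟨H.antidiag_north (by rw [hp]; split_ifs <;> omega), fun E N hc =>
        (hc.types_of_gt H h2 h3).2.2.2 _ (by omega) (by omega)⟩

/-! ### Translation into the bracket numbers -/

theorem crt_eq (H : IsIdempotent m n k l e) {i j x : ℤ} (a b : ℤ) (ha : x = i + m * a)
    (hb : x = j + n * b) (h1 : 1 ≤ x) (h2 : x ≤ m * n) : crt m n i j = x := by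
  have hm := H.three_le_left
  have hn := H.three_le_right
  refine (crt_spec (by omega) (by omega) H.gcd_eq_one i j).unique ⟨?_, ?_, h1, ?_⟩
  · exact (Int.modEq_iff_dvd.2 ⟨a, by rw [ha]; ring⟩).symm
  · exact (Int.modEq_iff_dvd.2 ⟨b, by rw [hb]; ring⟩).symm
  · rw [Nat.Coprime.lcm_eq_mul H.gcd_eq_one]
    exact_mod_cast h2

/-- The numbers of horizontal and vertical windings determine the rotation number. -/
theorem coprime_iff (H : IsIdempotent m n k l e) {K r : ℕ} {a b : ℤ} (hr : (r : ℤ) = l * a + k * b)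
    (hK : (K : ℤ) = m * a + n * b) : Nat.Coprime r K ↔ Int.gcd a b = 1 := by
  -- The matrix taking `(a, b)` to `(r, K)` has determinant 1, so it preserves coprimality.
  have hdet : n * l - m * k = 1 := by linear_combination H.eq_left - H.eq_right
  rw [← Int.isCoprime_iff_gcd_eq_one, ← Nat.isCoprime_iff_coprime]
  constructor
  · rintro ⟨u, v, huv⟩
    exact ⟨u * l + v * m, u * k + v * n, by rw [← huv, hr, hK]; ring⟩
  · rintro ⟨u, v, huv⟩
    refine ⟨u * n - v * m, v * l - u * k, ?_⟩
    rw [hr, hK]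
    linear_combination huv + (u * a + v * b) * hdet

/-- Since `e - 1 ≡ (0, -1)` and `-e ≡ (-1, 0)`, the brackets are `2e - 2`, `mn - 2e`, `e - 1`, `mn -
e`; only `mn - 2e < e - 1` is in question. -/
theorem min_crt_lt_iff_of_lt (H : IsIdempotent m n k l e) (h2 : 2 * e < m * n) :
    min (crt m n 0 (-2)) (crt m n (-2) 0) < min (crt m n 0 (-1)) (crt m n (-1) 0) ↔
      m * n + 1 < 3 * e := by
  have f1 := H.three_le
  have f2 := H.add_two_le
  have f3 := H.ne_one 3 1
  have e1 := H.eq_left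
  have e2 := H.eq_right
  rw [H.crt_eq (i := 0) (j := -2) (x := 2 * e - 2) (2 * k) (2 * l) (by linear_combination 2 * e1)
      (by linear_combination 2 * e2) (by omega) (by omega),
    H.crt_eq (i := -2) (j := 0) (x := m * n - 2 * e) (n - 2 * k) (m - 2 * l)
      (by linear_combination -2 * e1) (by linear_combination -2 * e2) (by omega) (by omega),
    H.crt_eq (i := 0) (j := -1) (x := e - 1) k l (by linear_combination e1)
      (by linear_combination e2) (by omega) (by omega),
    H.crt_eq (i := -1) (j := 0) (x := m * n - e) (n - k) (m - l)
      (by linear_combination -e1) (by linear_combination -e2) (by omega) (by omega)]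
  omega

theorem min_crt_lt_iff_of_gt (H : IsIdempotent m n k l e) (h2 : m * n < 2 * e) :
    min (crt m n 0 (-2)) (crt m n (-2) 0) < min (crt m n 0 (-1)) (crt m n (-1) 0) ↔
      3 * e < 2 * (m * n) + 2 := by
  have f1 := H.three_le
  have f2 := H.add_two_le
  have f3 := H.ne_one 2 1
  have f4 := H.ne_two 2 1
  have e1 := H.eq_left
  have e2 := H.eq_right
  rw [H.crt_eq (i := 0) (j := -2) (x := 2 * e - 2 - m * n) (2 * k - n) (2 * l - m)
      (by linear_combination 2 * e1) (by linear_combination 2 * e2) (by omega) (by omega),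
    H.crt_eq (i := -2) (j := 0) (x := 2 * (m * n) - 2 * e) (2 * n - 2 * k) (2 * m - 2 * l)
      (by linear_combination -2 * e1) (by linear_combination -2 * e2) (by omega) (by omega),
    H.crt_eq (i := 0) (j := -1) (x := e - 1) k l (by linear_combination e1)
      (by linear_combination e2) (by omega) (by omega),
    H.crt_eq (i := -1) (j := 0) (x := m * n - e) (n - k) (m - l)
      (by linear_combination -e1) (by linear_combination -e2) (by omega) (by omega)]
  omega

/-- The brackets are `4(e - 1) - mn` and `2mn - 4e`; `h2` and `h3` place them in `[1, mn]`. Their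
sum is `mn - 4`, the number of remaining vertices. -/
theorem gcd_crt_eq_of_lt (H : IsIdempotent m n k l e) (h2 : 2 * e < m * n)
    (h3 : m * n + 1 < 3 * e) :
    Int.gcd (crt m n 0 (-4) / (m : ℤ)) (crt m n (-4) 0 / (n : ℤ)) =
      Int.gcd (4 * k - n) (2 * m - 4 * l) := by
  have f1 := H.three_le
  have f2 := H.add_two_le
  have e1 := H.eq_left
  have e2 := H.eq_right
  have hm := H.three_le_left
  have hn := H.three_le_right
  rw [H.crt_eq (i := 0) (j := -4) (x := m * (4 * k - n)) (4 * k - n) (4 * l - m)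
      (by ring) (by linear_combination 4 * e2 - 4 * e1) (by linarith) (by linarith),
    H.crt_eq (i := -4) (j := 0) (x := n * (2 * m - 4 * l)) (2 * n - 4 * k) (2 * m - 4 * l)
      (by linear_combination 4 * e2 - 4 * e1) (by ring) (by linarith) (by linarith),
    Int.mul_ediv_cancel_left _ (by omega), Int.mul_ediv_cancel_left _ (by omega)]

theorem gcd_crt_eq_of_gt (H : IsIdempotent m n k l e) (h2 : m * n < 2 * e)
    (h3 : 3 * e < 2 * (m * n) + 2) :
    Int.gcd (crt m n 0 (-4) / (m : ℤ)) (crt m n (-4) 0 / (n : ℤ)) =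
      Int.gcd (4 * k - 2 * n) (3 * m - 4 * l) := by
  have f1 := H.three_le
  have f2 := H.add_two_le
  have f3 := H.ne_one 2 1
  have f4 := H.ne_two 2 1
  -- This excludes `2e = mn + 1` and `2e = mn + 2`, for which `4(e - 1) - 2mn` would not be
  -- positive.
  have f5 : m * n + 3 ≤ 2 * e := by omega
  have e1 := H.eq_left
  have e2 := H.eq_right
  have hm := H.three_le_left
  have hn := H.three_le_right
  rw [H.crt_eq (i := 0) (j := -4) (x := m * (4 * k - 2 * n)) (4 * k - 2 * n) (4 * l - 2 * m)
      (by ring) (by linear_combination 4 * e2 - 4 * e1) (by linarith) (by linarith),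
    H.crt_eq (i := -4) (j := 0) (x := n * (3 * m - 4 * l)) (3 * n - 4 * k) (3 * m - 4 * l)
      (by linear_combination 4 * e2 - 4 * e1) (by ring) (by linarith) (by linarith),
    Int.mul_ediv_cancel_left _ (by omega), Int.mul_ediv_cancel_left _ (by omega)]

end IsIdempotent

theorem exists_isIdempotent {m n : ℕ} (hm : 3 ≤ m) (hn : 3 ≤ n) (hg : Nat.gcd m n = 1) :
    ∃ k l e : ℤ, IsIdempotent m n k l e := by
  obtain ⟨h1, h2, h3, h4⟩ := crt_spec (by omega) (by omega) hg 1 0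
  obtain ⟨k, hk⟩ := h1.symm.dvd
  obtain ⟨l, hl⟩ := h2.symm.dvd
  rw [Nat.Coprime.lcm_eq_mul hg] at h4
  exact ⟨k, l, _, hm, hn, hg, by linarith, by linarith, h3, by exact_mod_cast h4⟩

end DirectedTorus

theorem corollary2p4 (m n : ℕ) (hm : 3 ≤ m) (hn : 3 ≤ n) :
    DirectedTorus.IsHamiltonian
        (DirectedTorus.deleteVerts
          (DirectedTorus.boxProd (DirectedTorus.directedCycle m) (DirectedTorus.directedCycle n))
          (DirectedTorus.rectangle m n 2 2)) ↔
      Nat.gcd m n = 1 ∧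
      min (DirectedTorus.crt m n 0 (-2)) (DirectedTorus.crt m n (-2) 0) <
        min (DirectedTorus.crt m n 0 (-1)) (DirectedTorus.crt m n (-1) 0) ∧
      Int.gcd (DirectedTorus.crt m n 0 (-4) / (m : ℤ)) (DirectedTorus.crt m n (-4) 0 / (n : ℤ)) =
        1 := by
  open DirectedTorus in
  by_cases hg : Nat.gcd m n = 1
  swap
  · refine iff_of_false ?_ fun h => hg h.1
    rintro ⟨k, hk, c, hc, hadj⟩
    rcases (Nat.dvd_prime Nat.prime_two).1 ((isCover_of_cycle hm hc hadj).gcd_dvd_two hm hn)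
      with h | h
    · exact hg h
    · exact gcd_ne_two_of_cycle hm hn hk hc hadj h
  obtain ⟨k, l, e, H⟩ := exists_isIdempotent hm hn hg
  have f1 := H.three_le
  have f2 := H.add_two_le
  have e1 := H.eq_left
  have e2 := H.eq_right
  have hM : (9 : ℤ) ≤ m * n := by exact_mod_cast Nat.mul_le_mul hm hn
  obtain ⟨K, hK⟩ := Int.eq_ofNat_of_zero_le (show (0 : ℤ) ≤ m * n - 4 by omega)
  rcases lt_or_gt_of_ne H.two_mul_ne with h2 | h2
  · rw [H.min_crt_lt_iff_of_lt h2]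
    by_cases h3 : (m * n : ℤ) + 1 < 3 * e
    · obtain ⟨r, hr⟩ := Int.eq_ofNat_of_zero_le (show 0 ≤ e - 2 by omega)
      rw [H.gcd_crt_eq_of_lt h2 h3, H.isHamiltonian_iff_of_lt h2 h3 hK.symm hr.symm,
        H.coprime_iff (a := 4 * k - n) (b := 2 * m - 4 * l) (by linear_combination 2 * e1 - e2 - hr)
          (by linear_combination 4 * e1 - 4 * e2 - hK)]
      exact ⟨fun h => ⟨hg, h3, h⟩, fun h => h.2.2⟩
    · refine iff_of_false ?_ fun h => h3 h.2.1
      rintro ⟨_, _, c, hc, hadj⟩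
      exact h3 ((isCover_of_cycle hm hc hadj).lt_three_mul H h2)
  · rw [H.min_crt_lt_iff_of_gt h2]
    by_cases h3 : 3 * e < 2 * (m * n : ℤ) + 2
    · obtain ⟨r, hr⟩ := Int.eq_ofNat_of_zero_le (show 0 ≤ e - 3 by omega)
      rw [H.gcd_crt_eq_of_gt h2 h3, H.isHamiltonian_iff_of_gt h2 h3 hK.symm hr.symm,
        H.coprime_iff (a := 4 * k - 2 * n) (b := 3 * m - 4 * l)
          (by linear_combination 3 * e1 - 2 * e2 - hr)
          (by linear_combination 4 * e1 - 4 * e2 - hK)]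
      exact ⟨fun h => ⟨hg, h3, h⟩, fun h => h.2.2⟩
    · refine iff_of_false ?_ fun h => h3 h.2.1
      rintro ⟨_, _, c, hc, hadj⟩
      exact h3 ((isCover_of_cycle hm hc hadj).three_mul_lt H h2)
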